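/- For a real $P>0$ let $X_P$ be the complex vector space of locally square summable $P$-periodic functions on $\mathbb R$ of zero mean value. For positive periods $\tau_1,\dots,\tau_n$ put $X=X_{\tau_1}+\cdots+X_{\tau_n}$. A number $T>0$ is the critical length of the periods if $X$ is dense in $L^2(0,S)$ for every $0<S<T$ and not dense in $L^2(0,S)$ for any $S>T$. A real-valued function $h\in L^2(0,T)$, extended by zero outside $(0,T)$, is called an orthogonal function for the periods if $T$ is their critical length and the closure of $X$ in $L^2(0,T)$ is the orthogonal complement of $h$. **Theorem.** Let $T_1,T_2,T_3$ be positive integers and $g=\gcd(T_1,T_2,T_3)$. There exist positive integers $p,q,r$ with $$\gcd(T_1,T_3)=qg,\qquad \gcd(T_2,T_3)=rg,\qquad T_3=pqrg,$$ the number $N:=pqr-q-r+1$ is nonnegative, and there exists a sequence $(a_j)_{j=0}^{N}$ of real numbers such that the following holds. The function $$t\mapsto\sum_{j=0}^{T_2/\gcd(T_1,T_2)-1}\chi_{[0,T_1)}\bigl(t-j\gcd(T_1,T_2)\bigr)$$ is an orthogonal function for the periods $T_1,T_2$. If $h_2$ is any orthogonal function for the periods $T_1,T_2$, then a function $h_3:\mathbb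 R\to\mathbb R$ is an orthogonal function for the periods $T_1,T_2,T_3$ if and only if there is a real constant $c\neq0$ with $$h_3(t)=c\sum_{j=0}^{N}a_j\,h_2(t-jg)\qquad\text{for almost every } t\in\mathbb R.$$ Furthermore, writing $0^k$ for a block of $k$ zeros and $w^\infty$ for the infinite repetition of a finite word $w$: 1. if $q=1$, then $N=pr-r$ and $(a_j)_{j=0}^{N}$ is the beginning of the sequence $(1,0^{r-1})^\infty$; 2. if $r=1$, then $N=pq-q$ and $(a_j)_{j=0}^{N}$ is the beginning of the sequence $(1,0^{q-1})^\infty$; 3. if $q\ge2$ and $r\ge2$, then $(a_j)_{j=0}^{N}$ is $qr$-periodic and it is the beginning of the $qr$-periodic infinite sequence $$\sum_{l=0}^{\infty}0^{lq}(1,-1,0^{r-2})^\infty=\sum_{l=0}^{\infty}0^{lr}(1,-1,0^{q-2})^\infty,$$ where the sums are taken termwise and $0^{k}s$ denotes the sequence $s$ preceded by $k$ zeros. -/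

import Mathlib

namespace PosOrth

noncomputable section

open MeasureTheory Set

/-- The vector space `X_P` of locally square summable, `P`-periodic functions `ℝ → ℂ`
of zero mean value. -/
def periodicSpace (P : ℝ) : Submodule ℂ (ℝ → ℂ) where
  carrier := {f | Function.Periodic f P ∧
    (∀ a b : ℝ, MemLp f 2 (volume.restrict (Icc a b))) ∧
    ∫ t in (0 : ℝ)..P, f t = 0}
  zero_mem' := ⟨fun _ => rfl, fun _ _ => MemLp.zero, by simp⟩
  add_mem' := by
    rintro f g ⟨hf1, hf2, hf3⟩ ⟨hg1, hg2, hg3⟩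
    have key : ∀ u : ℝ → ℂ, (∀ a b : ℝ, MemLp u 2 (volume.restrict (Icc a b))) →
        IntervalIntegrable u volume 0 P := by
      intro u hu
      rw [intervalIntegrable_iff]
      refine IntegrableOn.mono_set (t := Icc (min 0 P) (max 0 P)) ?_ Ioc_subset_Icc_self
      exact (hu _ _).integrable (by norm_num)
    refine ⟨hf1.add hg1, fun a b => (hf2 a b).add (hg2 a b), ?_⟩
    have h := intervalIntegral.integral_add (key f hf2) (key g hg2)
    rw [hf3, hg3, add_zero] at h
    exact h
  smul_mem' := by
    rintro c f ⟨hf1, hf2, hf3⟩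
    refine ⟨fun t => ?_, fun a b => (hf2 a b).const_smul c, ?_⟩
    · simp only [Pi.smul_apply, hf1 t]
    · have h := intervalIntegral.integral_smul (μ := volume) (a := 0) (b := P) c f
      rw [hf3, smul_zero] at h
      exact h

/-- The sum `X = X_{τ 0} + ⋯ + X_{τ (n-1)}` for the periods `τ`. -/
def sumSpace {n : ℕ} (τ : Fin n → ℝ) : Submodule ℂ (ℝ → ℂ) :=
  ⨆ i, periodicSpace (τ i)

/-- The complex Hilbert space `L²(0,S)`. -/
abbrev L2 (S : ℝ) : Type := Lp ℂ 2 (volume.restrict (Ioo (0 : ℝ) S))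

/-- The subspace of `L²(0,S)` formed by the restrictions to `(0,S)` of the elements of `X`. -/
def restricted (X : Submodule ℂ (ℝ → ℂ)) (S : ℝ) : Submodule ℂ (L2 S) where
  carrier := {u | ∃ f ∈ X, u =ᵐ[volume.restrict (Ioo (0 : ℝ) S)] f}
  zero_mem' := ⟨0, X.zero_mem, Lp.coeFn_zero _ _ _⟩
  add_mem' := by
    rintro u v ⟨f, hf, huf⟩ ⟨g, hg, hvg⟩
    exact ⟨f + g, X.add_mem hf hg, (Lp.coeFn_add u v).trans (huf.add hvg)⟩
  smul_mem' := by
    rintro c u ⟨f, hf, huf⟩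
    exact ⟨c • f, X.smul_mem c hf, (Lp.coeFn_smul c u).trans (huf.const_smul c)⟩

/-- `T` is the critical length for the periods `τ`: the sum space is dense in `L²(0,S)` for all
`0 < S < T`, and it is not dense in `L²(0,S)` for any `S > T`. -/
def IsCriticalLength {n : ℕ} (τ : Fin n → ℝ) (T : ℝ) : Prop :=
  0 < T ∧
  (∀ S, 0 < S → S < T → (restricted (sumSpace τ) S).topologicalClosure = ⊤) ∧
  (∀ S, T < S → (restricted (sumSpace τ) S).topologicalClosure ≠ ⊤)

/-- `h` is an orthogonal function for the periods `τ`: a real-valued function that belongs to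
`L²(0,T)`, where `T` is the critical length, is extended by zero outside `(0,T)`, and whose
orthogonal complement in `L²(0,T)` is the closure of the sum space. -/
def IsOrthogonalFunction {n : ℕ} (τ : Fin n → ℝ) (h : ℝ → ℝ) : Prop :=
  ∃ T : ℝ, IsCriticalLength τ T ∧
    (∀ᵐ t : ℝ, t ∉ Ioo 0 T → h t = 0) ∧
    ∃ hL : MemLp (fun t => (h t : ℂ)) 2 (volume.restrict (Ioo (0 : ℝ) T)),
      (restricted (sumSpace τ) T).topologicalClosure = (Submodule.span ℂ {hL.toLp})ᗮ

/-- The characteristic function of `[0, T₁)`. -/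
def h1 (T₁ : ℕ) : ℝ → ℝ := (Ico (0 : ℝ) T₁).indicator 1

/-- The function `∑_{j=0}^{T₂/gcd(T₁,T₂) - 1} h₁(t - j gcd(T₁,T₂))`. -/
def h2 (T₁ T₂ : ℕ) (t : ℝ) : ℝ :=
  ∑ j ∈ Finset.range (T₂ / Nat.gcd T₁ T₂), h1 T₁ (t - j * Nat.gcd T₁ T₂)

/-- The infinite sequence `w^∞ = w, w, w, …` for a nonempty finite word `w`. -/
def wordPow (w : List ℝ) (j : ℕ) : ℝ := w.getD (j % w.length) 0

/-- The sequence `0^k s`, that is, `k` zeros followed by the sequence `s`. -/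
def zerosThen (k : ℕ) (s : ℕ → ℝ) (j : ℕ) : ℝ := if j < k then 0 else s (j - k)

/-- The sequence `(1, 0^{r-1})^∞`, for `r ≥ 1`. -/
def oneZeros (r : ℕ) : ℕ → ℝ := wordPow (1 :: List.replicate (r - 1) 0)

/-- The sequence `(1, -1, 0^{r-2})^∞`, for `r ≥ 2`. -/
def oneMinusOneZeros (r : ℕ) : ℕ → ℝ := wordPow (1 :: -1 :: List.replicate (r - 2) 0)

/-- The termwise sum `∑_{l=0}^∞ 0^{lq} (1, -1, 0^{r-2})^∞`, for `q ≥ 1` and `r ≥ 2`; in each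
position only finitely many summands are nonzero. -/
def shiftedSum (q r : ℕ) (j : ℕ) : ℝ := ∑' l : ℕ, zerosThen (l * q) (oneMinusOneZeros r) j

end

end PosOrth

/-!
A function `h` in `L²(0,S)` is orthogonal to the zero mean `P`-periodic functions exactly when its
periodization `x ↦ ∑ₖ h (x + k P)` is constant almost everywhere (`forall_periodicSpace_iff`).
Let all periods be integer multiples `tᵢ g` of a common `g`, and attach to almost every `x` in
`[0,g)` the generating polynomial `Fₓ = ∑ₖ h (x + k g) Xᵏ`. The sums of the coefficients of `Fₓ` over
the residue classes modulo `tᵢ` determine `Fₓ` modulo `X^tᵢ - 1`, so that orthogonality for the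
period `tᵢ g` says: `1 + X + ⋯ + X^(tᵢ-1)` divides `Fₓ`, and `Fₓ(1)` does not depend on `x`
(`forall_periodicSpace_iff_fiber`).

Let `Q` be the least common multiple of these divisors. All of them are nonzero at `1`, hence so
is `Q`. If `S ≤ (deg Q + 1) g` then `deg Fₓ ≤ deg Q`, so `Fₓ = c Q` with `c = Fₓ(1) / Q(1)`
independent of `x`: the function `h` is `c` times the step function whose values on the intervals
`[k g, (k+1) g)` are the coefficients of `Q` (`IsStepPoly.exists_ae_eq`). Consequently
`(deg Q + 1) g` is the critical length, and the orthogonal functions are the nonzero real multiples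
of this step function (`IsStepPoly.isOrthogonalFunction_iff`).

It remains to compute least common multiples. For two periods it is
`(X^t₁ - 1) (X^t₂ - 1) / ((X - 1) (X^d - 1))`, `d = gcd(t₁,t₂)` (`pairPoly_dvd_iff`). When
`gcd(t₁,t₂,t₃) = 1`, a third period, with `q = gcd(t₁,t₃)`, `r = gcd(t₂,t₃)` and `t₃ = pqr`,
multiplies it by `A = (1 - X) (1 - X^(pqr)) / ((1 - X^q) (1 - X^r))`, since the common part of
`X^t₃ - 1` with the other two polynomials has the roots `z` with `z^q = 1` or `z^r = 1`
(`pairPoly_mul_dvd_iff`). Multiplication of polynomials corresponds to summing shifts of step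
functions (`stepFn_mul`), so the `a_j` are the coefficients of `A`. As `deg A < pqr`, they are the
first coefficients of the power series `(1 - X) / ((1 - X^q) (1 - X^r))`, which is the generating
function of the sequences in the statement. It is symmetric in `q` and `r`, and the case `p = 1`
shows that its product with `1 - X^(qr)` is a polynomial of degree less than `qr`, whence the
periodicity.
-/

namespace PosOrth

open Polynomial Finset

/-! ### Least common multiples of geometric sum polynomials -/

section GeometricSums

variable (k : Type*) [Field k]

/-- The polynomial `1 + X + ⋯ + X^(t-1) = (X^t - 1) / (X - 1)`. -/
noncomputable def geomPoly (t : ℕ) : k[X] := ∑ j ∈ range t, X ^ j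

/-- The polynomial `(X^t₁ - 1) (X^t₂ - 1) / ((X - 1) (X^d - 1))` with `d = gcd t₁ t₂`; it is the
least common multiple of `geomPoly k t₁` and `geomPoly k t₂`. -/
noncomputable def pairPoly (t₁ t₂ : ℕ) : k[X] :=
  geomPoly k t₁ * ∑ j ∈ range (t₂ / t₁.gcd t₂), X ^ (j * t₁.gcd t₂)

lemma geomPoly_mul_X_sub_one (t : ℕ) : geomPoly k t * (X - 1) = X ^ t - 1 := geom_sum_mul X t

lemma geomPoly_mul (m d : ℕ) :
    geomPoly k d * ∑ j ∈ range m, X ^ (j * d) = geomPoly k (m * d) := by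
  have h0 : (X - 1 : k[X]) ≠ 0 := by simpa using X_sub_C_ne_zero (1 : k)
  refine mul_right_cancel₀ h0 ?_
  have h := geom_sum_mul (X ^ d : k[X]) m
  simp_rw [← pow_mul, mul_comm d] at h
  rw [mul_right_comm, geomPoly_mul_X_sub_one, geomPoly_mul_X_sub_one, mul_comm, h]

lemma geomPoly_dvd_geomPoly {s t : ℕ} (h : s ∣ t) : geomPoly k s ∣ geomPoly k t := by
  obtain ⟨m, rfl⟩ := h
  exact ⟨_, by rw [geomPoly_mul, mul_comm]⟩

lemma coeff_geomPoly (t n : ℕ) : (geomPoly k t).coeff n = if n < t then 1 else 0 := by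
  simp [geomPoly, coeff_X_pow]

lemma geomPoly_ne_zero {t : ℕ} (ht : 0 < t) : geomPoly k t ≠ 0 := fun h => by
  simpa [h, ht] using coeff_geomPoly k t 0

lemma eval_one_geomPoly (t : ℕ) : (geomPoly k t).eval 1 = t := by
  simp [geomPoly, eval_finsetSum]

lemma natDegree_geomPoly (t : ℕ) : (geomPoly k t).natDegree = t - 1 := by
  rcases t.eq_zero_or_pos with rfl | ht
  · simp [geomPoly]
  refine natDegree_eq_of_le_of_coeff_ne_zero ?_ ?_
  · exact natDegree_sum_le_of_forall_le _ _ fun j hj => by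
      rw [natDegree_X_pow]; have := mem_range.1 hj; omega
  · rw [coeff_geomPoly, if_pos (by omega)]; exact one_ne_zero

@[simp] lemma map_geomPoly {K : Type*} [Field K] (f : k →+* K) (t : ℕ) :
    (geomPoly k t).map f = geomPoly K t := by
  simp [geomPoly, Polynomial.map_sum]

@[simp] lemma map_pairPoly {K : Type*} [Field K] (f : k →+* K) (t₁ t₂ : ℕ) :
    (pairPoly k t₁ t₂).map f = pairPoly K t₁ t₂ := by
  simp [pairPoly, Polynomial.map_sum]

lemma eval_one_pairPoly (t₁ t₂ : ℕ) :
    (pairPoly k t₁ t₂).eval 1 = t₁ * (t₂ / t₁.gcd t₂ : ℕ) := by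
  simp [pairPoly, eval_one_geomPoly, eval_finsetSum]

variable [Algebra k ℂ]

lemma aeval_one_geomPoly_ne_zero {t : ℕ} (ht : 0 < t) : aeval (1 : ℂ) (geomPoly k t) ≠ 0 := by
  simpa [geomPoly] using ht.ne'

variable {k}

lemma pow_eq_one_of_aeval_geomPoly {t : ℕ} {z : ℂ} (h : aeval z (geomPoly k t) = 0) :
    z ^ t = 1 := by
  have := congrArg (aeval z) (geomPoly_mul_X_sub_one k t)
  simp only [map_mul, h, zero_mul, map_sub, map_pow, aeval_X, map_one] at this
  exact (sub_eq_zero.1 this.symm)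

lemma aeval_geomPoly_eq_zero {t : ℕ} {z : ℂ} (h : z ^ t = 1) (hz : z ≠ 1) :
    aeval z (geomPoly k t) = 0 := by
  have := congrArg (aeval z) (geomPoly_mul_X_sub_one k t)
  simp only [map_mul, map_sub, map_pow, aeval_X, map_one, h, sub_self] at this
  exact (mul_eq_zero.1 this).resolve_right (sub_ne_zero.2 hz)

lemma isCoprime_of_forall_aeval {f g : k[X]}
    (h : ∀ z : ℂ, aeval z f = 0 → aeval z g = 0 → False) : IsCoprime f g := by
  rw [isCoprime_iff_aeval_ne_zero_of_isAlgClosed k ℂ]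
  intro z
  by_contra! hz
  exact h z hz.1 hz.2

lemma pow_gcd_eq_one_of_pow_eq_one {z : ℂ} {m n : ℕ} (hm : z ^ m = 1) (hn : z ^ n = 1) :
    z ^ m.gcd n = 1 :=
  orderOf_dvd_iff_pow_eq_one.1
    (Nat.dvd_gcd (orderOf_dvd_of_pow_eq_one hm) (orderOf_dvd_of_pow_eq_one hn))

lemma isCoprime_geomPoly {q r : ℕ} (hq : 0 < q) (h : q.Coprime r) :
    IsCoprime (geomPoly k q) (geomPoly k r) := by
  refine isCoprime_of_forall_aeval fun z h₁ h₂ => ?_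
  have hz := pow_gcd_eq_one_of_pow_eq_one (pow_eq_one_of_aeval_geomPoly h₁)
    (pow_eq_one_of_aeval_geomPoly h₂)
  rw [h, pow_one] at hz
  exact aeval_one_geomPoly_ne_zero k hq (hz ▸ h₁)

/-- The two factors of `pairPoly` are coprime: at a common root `z` one has `z ^ gcd t₁ t₂ = 1`,
so that the second factor takes the value `t₂ / gcd t₁ t₂ ≠ 0`. -/
lemma pairPoly_dvd_iff {t₁ t₂ : ℕ} (h₂ : 0 < t₂) (p : k[X]) :
    pairPoly k t₁ t₂ ∣ p ↔ geomPoly k t₁ ∣ p ∧ geomPoly k t₂ ∣ p := by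
  have hW : geomPoly k (t₁.gcd t₂) * ∑ j ∈ range (t₂ / t₁.gcd t₂), X ^ (j * t₁.gcd t₂) =
      geomPoly k t₂ := by
    rw [geomPoly_mul, Nat.div_mul_cancel (Nat.gcd_dvd_right _ _)]
  constructor
  · intro h
    refine ⟨(dvd_mul_right _ _).trans h, dvd_trans ?_ h⟩
    rw [← hW]
    exact mul_dvd_mul_right (geomPoly_dvd_geomPoly k (Nat.gcd_dvd_left _ _)) _
  · rintro ⟨h1, h2⟩
    refine IsCoprime.mul_dvd (isCoprime_of_forall_aeval fun z hz hW0 => ?_) h1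
      ((Dvd.intro_left _ hW).trans h2)
    have hz2 : aeval z (geomPoly k t₂) = 0 := by rw [← hW, map_mul, hW0, mul_zero]
    have hd := pow_gcd_eq_one_of_pow_eq_one (pow_eq_one_of_aeval_geomPoly hz)
      (pow_eq_one_of_aeval_geomPoly hz2)
    have : ((t₂ / t₁.gcd t₂ : ℕ) : ℂ) = 0 := by
      simpa [mul_comm _ (t₁.gcd t₂), pow_mul, hd] using hW0
    rw [Nat.cast_eq_zero] at this
    exact (Nat.div_pos (Nat.gcd_le_right _ h₂) (Nat.gcd_pos_of_pos_right _ h₂)).ne' this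

/-- If `A` is the cofactor of `geomPoly k q * geomPoly k r` in `geomPoly k t₃`, then `A` has no
root in common with `pairPoly k t₁ t₂`: such a root would be a root of `geomPoly k q` or
`geomPoly k r`, hence a double root of the separable polynomial `X ^ t₃ - 1`. -/
lemma pairPoly_mul_dvd_iff {t₁ t₂ t₃ : ℕ} (h₁ : 0 < t₁) (h₂ : 0 < t₂) (h₃ : 0 < t₃)
    (hcop : (t₁.gcd t₃).Coprime (t₂.gcd t₃)) {A : k[X]}
    (hA : A * (geomPoly k (t₁.gcd t₃) * geomPoly k (t₂.gcd t₃)) = geomPoly k t₃) (p : k[X]) :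
    pairPoly k t₁ t₂ * A ∣ p ↔ geomPoly k t₁ ∣ p ∧ geomPoly k t₂ ∣ p ∧ geomPoly k t₃ ∣ p := by
  have hpair := (pairPoly_dvd_iff (k := k) (t₁ := t₁) h₂ (pairPoly k t₁ t₂)).1 dvd_rfl
  have : CharZero k := (algebraMap k ℂ).charZero
  constructor
  · intro h
    have hp := (pairPoly_dvd_iff h₂ p).1 ((dvd_mul_right _ _).trans h)
    refine ⟨hp.1, hp.2, dvd_trans ?_ h⟩
    rw [← hA, mul_comm A]
    refine mul_dvd_mul_right (IsCoprime.mul_dvd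
      (isCoprime_geomPoly (Nat.gcd_pos_of_pos_left _ h₁) hcop) ?_ ?_) _
    · exact (geomPoly_dvd_geomPoly k (Nat.gcd_dvd_left _ _)).trans hpair.1
    · exact (geomPoly_dvd_geomPoly k (Nat.gcd_dvd_left _ _)).trans hpair.2
  · rintro ⟨hp1, hp2, hp3⟩
    refine IsCoprime.mul_dvd ?_ ((pairPoly_dvd_iff h₂ p).2 ⟨hp1, hp2⟩)
      ((Dvd.intro _ hA).trans hp3)
    refine isCoprime_of_forall_aeval fun z hz hAz => ?_
    have hz3 : aeval z (geomPoly k t₃) = 0 := by rw [← hA, map_mul, hAz, zero_mul]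
    have hz1 : z ≠ 1 := by
      rintro rfl
      exact aeval_one_geomPoly_ne_zero k h₃ hz3
    have hsq : aeval z (geomPoly k (t₁.gcd t₃) * geomPoly k (t₂.gcd t₃)) = 0 := by
      have hz12 : aeval z (geomPoly k t₁ * geomPoly k t₂) = 0 := by
        obtain ⟨c, hc⟩ : pairPoly k t₁ t₂ ∣ geomPoly k t₁ * geomPoly k t₂ :=
          (pairPoly_dvd_iff h₂ _).2 ⟨dvd_mul_right _ _, dvd_mul_left _ _⟩
        rw [hc, map_mul, hz, zero_mul]
      rw [map_mul, mul_eq_zero] at hz12 ⊢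
      have h3 := pow_eq_one_of_aeval_geomPoly hz3
      exact hz12.imp
        (fun h => aeval_geomPoly_eq_zero
          (pow_gcd_eq_one_of_pow_eq_one (pow_eq_one_of_aeval_geomPoly h) h3) hz1)
        (fun h => aeval_geomPoly_eq_zero
          (pow_gcd_eq_one_of_pow_eq_one (pow_eq_one_of_aeval_geomPoly h) h3) hz1)
    have hsep : (X ^ t₃ - 1 : k[X]).Separable :=
      separable_X_pow_sub_C 1 (by exact_mod_cast h₃.ne') one_ne_zero
    have hcop' : IsCoprime A (geomPoly k (t₁.gcd t₃) * geomPoly k (t₂.gcd t₃)) := by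
      refine Separable.isCoprime (hsep.of_dvd ?_)
      rw [hA, ← geomPoly_mul_X_sub_one]
      exact dvd_mul_right _ _
    exact ((isCoprime_iff_aeval_ne_zero_of_isAlgClosed k ℂ _ _).1 hcop' z).elim
      (fun h => h hAz) (fun h => h hsq)

end GeometricSums

/-! ### The coefficients of the cofactor `(1 - X) (1 - X^(pqr)) / ((1 - X^q) (1 - X^r))` -/

section Cofactor

/-- The polynomial `(X - 1) (X^(pqr) - 1) / ((X^q - 1) (X^r - 1))`, given by its defining
equation; its coefficients are the sequence `(a_j)`. -/
lemma exists_cofactor {p q r : ℕ} (hq : 0 < q) (h : q.Coprime r) :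
    ∃ A : ℝ[X], A * (geomPoly ℝ q * geomPoly ℝ r) = geomPoly ℝ (p * q * r) := by
  obtain ⟨A, hA⟩ := (isCoprime_geomPoly (k := ℝ) hq h).mul_dvd
    (geomPoly_dvd_geomPoly ℝ (t := p * q * r) ⟨p * r, by ring⟩)
    (geomPoly_dvd_geomPoly ℝ (t := p * q * r) ⟨p * q, by ring⟩)
  exact ⟨A, by rw [hA, mul_comm]⟩

variable {p q r : ℕ} {A : ℝ[X]}

lemma natDegree_cofactor (hp : 0 < p) (hq : 0 < q) (hr : 0 < r)
    (hA : A * (geomPoly ℝ q * geomPoly ℝ r) = geomPoly ℝ (p * q * r)) :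
    A.natDegree + q + r = p * q * r + 1 := by
  have h0 : A ≠ 0 := by
    rintro rfl
    exact geomPoly_ne_zero ℝ (t := p * q * r) (by positivity) (by rw [← hA, zero_mul])
  have := congrArg natDegree hA
  rw [natDegree_mul h0 (mul_ne_zero (geomPoly_ne_zero ℝ hq) (geomPoly_ne_zero ℝ hr)),
    natDegree_mul (geomPoly_ne_zero ℝ hq) (geomPoly_ne_zero ℝ hr), natDegree_geomPoly,
    natDegree_geomPoly, natDegree_geomPoly] at this
  have : 0 < p * q * r := by positivity
  omega

lemma cofactor_mul (hA : A * (geomPoly ℝ q * geomPoly ℝ r) = geomPoly ℝ (p * q * r)) :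
    A * ((1 - X ^ q) * (1 - X ^ r)) = (1 - X) * (1 - X ^ (p * q * r)) := by
  have e (t : ℕ) : (1 - X ^ t : ℝ[X]) = geomPoly ℝ t * (1 - X) := by
    linear_combination geomPoly_mul_X_sub_one ℝ t
  rw [e, e, e, ← hA]
  ring

lemma one_sub_X_pow_ne_zero {n : ℕ} (hn : 0 < n) : (1 - PowerSeries.X ^ n : PowerSeries ℝ) ≠ 0 := by
  intro h
  simpa [hn.ne'] using congrArg PowerSeries.constantCoeff h

lemma coeff_eq_of_eq_mul {F : PowerSeries ℝ} {n : ℕ}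
    (h : (A : PowerSeries ℝ) = F * (1 - PowerSeries.X ^ n)) {j : ℕ} (hj : j < n) :
    A.coeff j = PowerSeries.coeff j F := by
  rw [← coeff_coe, h, mul_sub, mul_one, map_sub, PowerSeries.coeff_mul_X_pow', if_neg (by omega),
    sub_zero]

lemma mk_wordPow_mul (w : List ℝ) :
    PowerSeries.mk (wordPow w) * (1 - PowerSeries.X ^ w.length) =
      PowerSeries.mk fun j => w.getD j 0 := by
  ext j
  rw [mul_sub, mul_one, map_sub, PowerSeries.coeff_mul_X_pow']
  simp only [PowerSeries.coeff_mk, wordPow]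
  split_ifs with h
  · rw [← Nat.mod_eq_sub_mod h, sub_self, List.getD_eq_default _ _ h]
  · rw [Nat.mod_eq_of_lt (by omega), sub_zero]

lemma mk_oneZeros_mul (hr : 0 < r) :
    PowerSeries.mk (oneZeros r) * (1 - PowerSeries.X ^ r) = 1 := by
  have := mk_wordPow_mul (1 :: List.replicate (r - 1) 0)
  rw [List.length_cons, List.length_replicate, Nat.sub_add_cancel hr] at this
  rw [oneZeros, this]
  ext j
  rcases j with _ | j
  · simp
  · simp [PowerSeries.coeff_one]

lemma mk_oneMinusOneZeros_mul (hr : 2 ≤ r) :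
    PowerSeries.mk (oneMinusOneZeros r) * (1 - PowerSeries.X ^ r) = 1 - PowerSeries.X := by
  have := mk_wordPow_mul (1 :: -1 :: List.replicate (r - 2) 0)
  rw [List.length_cons, List.length_cons, List.length_replicate,
    show r - 2 + 1 + 1 = r by omega] at this
  rw [oneMinusOneZeros, this]
  ext j
  rcases j with _ | _ | j
  · simp
  · simp [PowerSeries.coeff_one]
  · simp [PowerSeries.coeff_one, PowerSeries.coeff_X]

/-- The recursion obtained by splitting off the summand `l = 0`; it says that the generating
function of `shiftedSum q r` times `1 - X^q` is that of `oneMinusOneZeros r`. -/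
lemma shiftedSum_eq (hq : 0 < q) (j : ℕ) :
    shiftedSum q r j = oneMinusOneZeros r j + if q ≤ j then shiftedSum q r (j - q) else 0 := by
  have hs (j : ℕ) : Summable fun l : ℕ => zerosThen (l * q) (oneMinusOneZeros r) j := by
    refine summable_of_ne_finset_zero (s := range (j + 1)) fun l hl => ?_
    have : j < l := by simpa using hl
    exact if_pos (this.trans_le (Nat.le_mul_of_pos_right l hq))
  rw [shiftedSum, (hs j).tsum_eq_zero_add]
  congr 1
  · simp [zerosThen]
  · split_ifs with h
    · refine tsum_congr fun l => ?_
      simp only [zerosThen, add_mul, one_mul]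
      by_cases h' : j < l * q + q
      · rw [if_pos h', if_pos (by omega)]
      · rw [if_neg h', if_neg (by omega), Nat.sub_sub, add_comm q]
    · refine (tsum_congr fun l => if_pos ?_).trans tsum_zero
      rw [add_mul, one_mul]
      omega

lemma mk_shiftedSum_mul (hq : 0 < q) :
    PowerSeries.mk (shiftedSum q r) * (1 - PowerSeries.X ^ q) =
      PowerSeries.mk (oneMinusOneZeros r) := by
  ext j
  rw [mul_sub, mul_one, map_sub, PowerSeries.coeff_mul_X_pow']
  simp only [PowerSeries.coeff_mk]
  rw [shiftedSum_eq hq j]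
  ring

lemma mk_shiftedSum_mul_mul (hq : 0 < q) (hr : 2 ≤ r) :
    PowerSeries.mk (shiftedSum q r) * ((1 - PowerSeries.X ^ q) * (1 - PowerSeries.X ^ r)) =
      1 - PowerSeries.X := by
  rw [← mul_assoc, mk_shiftedSum_mul hq, mk_oneMinusOneZeros_mul hr]

lemma shiftedSum_comm (hq : 2 ≤ q) (hr : 2 ≤ r) : shiftedSum q r = shiftedSum r q := by
  have h1 := mk_shiftedSum_mul_mul (q := q) (by omega) hr
  have h2 := mk_shiftedSum_mul_mul (q := r) (by omega) hq
  rw [mul_comm (1 - PowerSeries.X ^ r), ← h1] at h2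
  have := mul_right_cancel₀ (mul_ne_zero (one_sub_X_pow_ne_zero (by omega))
    (one_sub_X_pow_ne_zero (by omega))) h2
  funext j
  simpa using (congrArg (PowerSeries.coeff j) this).symm

lemma coe_cofactor_mul (hA : A * (geomPoly ℝ q * geomPoly ℝ r) = geomPoly ℝ (p * q * r)) :
    (A : PowerSeries ℝ) * ((1 - PowerSeries.X ^ q) * (1 - PowerSeries.X ^ r)) =
      (1 - PowerSeries.X) * (1 - PowerSeries.X ^ (p * q * r)) := by
  have := congrArg (fun P : ℝ[X] => (P : PowerSeries ℝ)) (cofactor_mul hA)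
  simpa using this

lemma coe_cofactor (hq : 0 < q) (hr : 2 ≤ r)
    (hA : A * (geomPoly ℝ q * geomPoly ℝ r) = geomPoly ℝ (p * q * r)) :
    (A : PowerSeries ℝ) = PowerSeries.mk (shiftedSum q r) * (1 - PowerSeries.X ^ (p * q * r)) := by
  refine mul_right_cancel₀ (mul_ne_zero (one_sub_X_pow_ne_zero hq)
    (one_sub_X_pow_ne_zero (n := r) (by omega))) ?_
  rw [coe_cofactor_mul hA]
  linear_combination (-(1 - PowerSeries.X ^ (p * q * r)) : PowerSeries ℝ) *
    mk_shiftedSum_mul_mul hq hr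

/-- Multiplying by `1 - X^(qr)` turns the generating function of `shiftedSum q r` into the
cofactor for `p = 1`, a polynomial of degree less than `qr`. -/
lemma shiftedSum_periodic (hq : 2 ≤ q) (hr : 2 ≤ r) (h : q.Coprime r) :
    Function.Periodic (shiftedSum q r) (q * r) := by
  obtain ⟨A, hA⟩ := exists_cofactor (p := 1) (by omega) h
  intro j
  have hd := natDegree_cofactor one_pos (by omega) (by omega) hA
  have hc := congrArg (PowerSeries.coeff (j + q * r)) (coe_cofactor (by omega) hr hA)
  rw [one_mul] at hd hc
  rw [coeff_coe, coeff_eq_zero_of_natDegree_lt (by omega), mul_sub, mul_one, map_sub,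
    PowerSeries.coeff_mul_X_pow] at hc
  simp only [PowerSeries.coeff_mk] at hc
  linarith

lemma coeff_cofactor_of_two_le (hp : 0 < p) (hq : 2 ≤ q) (hr : 2 ≤ r)
    (hA : A * (geomPoly ℝ q * geomPoly ℝ r) = geomPoly ℝ (p * q * r)) {j : ℕ}
    (hj : j ≤ A.natDegree) : A.coeff j = shiftedSum q r j := by
  have hd := natDegree_cofactor hp (by omega) (by omega) hA
  rw [coeff_eq_of_eq_mul (coe_cofactor (by omega) hr hA) (by omega), PowerSeries.coeff_mk]

lemma coeff_cofactor_of_eq_one (hp : 0 < p) (hr : 0 < r)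
    (hA : A * geomPoly ℝ r = geomPoly ℝ (p * r)) {j : ℕ}
    (hj : j ≤ A.natDegree) : A.coeff j = oneZeros r j := by
  have hone : geomPoly ℝ 1 = 1 := by simp [geomPoly]
  have hA' : A * (geomPoly ℝ 1 * geomPoly ℝ r) = geomPoly ℝ (p * 1 * r) := by
    rw [hone, one_mul, mul_one, hA]
  have hd := natDegree_cofactor hp one_pos hr hA'
  have hF : (A : PowerSeries ℝ) =
      PowerSeries.mk (oneZeros r) * (1 - PowerSeries.X ^ (p * 1 * r)) := by
    refine mul_right_cancel₀ (mul_ne_zero (one_sub_X_pow_ne_zero one_pos)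
      (one_sub_X_pow_ne_zero hr)) ?_
    rw [coe_cofactor_mul hA', pow_one]
    linear_combination (-(1 - PowerSeries.X) * (1 - PowerSeries.X ^ (p * 1 * r)) :
      PowerSeries ℝ) * mk_oneZeros_mul hr
  rw [coeff_eq_of_eq_mul hF (by omega), PowerSeries.coeff_mk]

end Cofactor

end PosOrth

namespace PosOrth

open MeasureTheory Set Finset
open scoped ComplexConjugate

/-! ### Orthogonality to periodic functions and periodizations -/

section Periodization

lemma memLp_translate {u : ℝ → ℂ} (hu : MemLp u 2 volume) (s : ℝ) :
    MemLp (fun x => u (x + s)) 2 volume :=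
  hu.comp_measurePreserving (measurePreserving_add_right volume s)

lemma memLp_of_periodic {f : ℝ → ℂ} {P : ℝ} (hP : 0 < P) (hf : Function.Periodic f P)
    (hL : MemLp f 2 (volume.restrict (Ioc 0 P))) (a b : ℝ) :
    MemLp f 2 (volume.restrict (Icc a b)) := by
  have hf1 : IntervalIntegrable f volume 0 P :=
    (intervalIntegrable_iff_integrableOn_Ioc_of_le hP.le).2 (hL.integrable (by norm_num))
  have hf2 : IntervalIntegrable (fun x => ‖f x‖ ^ 2) volume 0 P :=
    (intervalIntegrable_iff_integrableOn_Ioc_of_le hP.le).2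
      ((memLp_two_iff_integrable_sq_norm hL.1).1 hL)
  have h1 : IntegrableOn f (Icc a b) := by
    rcases le_or_gt a b with h | h
    · rw [integrableOn_Icc_iff_integrableOn_Ioc,
        ← intervalIntegrable_iff_integrableOn_Ioc_of_le h]
      exact hf.intervalIntegrable₀ hP.ne' hf1 a b
    · simp [Icc_eq_empty_of_lt h]
  refine (memLp_two_iff_integrable_sq_norm h1.1).2 ?_
  change IntegrableOn _ (Icc a b)
  rcases le_or_gt a b with h | h
  · rw [integrableOn_Icc_iff_integrableOn_Ioc,
      ← intervalIntegrable_iff_integrableOn_Ioc_of_le h]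
    exact (hf.comp fun z => ‖z‖ ^ 2).intervalIntegrable₀ hP.ne' hf2 a b
  · simp [Icc_eq_empty_of_lt h]

lemma integrableOn_conj_mul {f u : ℝ → ℂ} {a b : ℝ}
    (hf : MemLp f 2 (volume.restrict (Icc a b))) (hu : MemLp u 2 volume) :
    IntegrableOn (fun x => conj (f x) * u x) (Icc a b) :=
  MemLp.integrable_mul hf.star (hu.restrict _)

/-- Unfolding: integrating a periodic function against `u` amounts to integrating it over one
period against the periodization of `u`. -/
lemma integral_conj_mul_eq {f u : ℝ → ℂ} {P : ℝ} (hf : Function.Periodic f P)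
    (hL : ∀ a b : ℝ, MemLp f 2 (volume.restrict (Icc a b))) (hu : MemLp u 2 volume) (M : ℕ) :
    ∫ x in (0 : ℝ)..M * P, conj (f x) * u x =
      ∫ x in (0 : ℝ)..P, conj (f x) * ∑ k ∈ range M, u (x + k * P) := by
  have hI (v : ℝ → ℂ) (hv : MemLp v 2 volume) (a b : ℝ) :
      IntervalIntegrable (fun x => conj (f x) * v x) volume a b := by
    rw [intervalIntegrable_iff]
    exact (integrableOn_conj_mul (hL _ _) hv).mono_set Ioc_subset_Icc_self
  have h := intervalIntegral.sum_integral_adjacent_intervals (μ := volume)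
    (f := fun x => conj (f x) * u x) (a := fun k : ℕ => k * P) (n := M) fun k _ => hI u hu _ _
  simp only [Nat.cast_zero, zero_mul] at h
  rw [← h]
  simp_rw [mul_sum]
  rw [intervalIntegral.integral_finsetSum fun k _ => hI _ (memLp_translate hu _) _ _]
  refine sum_congr rfl fun k _ => ?_
  have := intervalIntegral.integral_comp_add_right (a := 0) (b := P)
    (fun x => conj (f x) * u x) (k * P)
  rw [zero_add, show P + k * P = ((k + 1 : ℕ) : ℝ) * P by push_cast; ring] at this
  rw [← this]
  refine intervalIntegral.integral_congr fun x _ => ?_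
  simp only [hf.nat_mul k x]

/-- A function is orthogonal to the zero mean `P`-periodic functions if and only if its
`P`-periodization is constant. For the forward direction the test function is the difference of
the periodization and its mean value. -/
lemma forall_periodicSpace_iff {u : ℝ → ℂ} {P : ℝ} (hP : 0 < P) (hu : MemLp u 2 volume) (M : ℕ) :
    (∀ f ∈ periodicSpace P, ∫ x in (0 : ℝ)..M * P, conj (f x) * u x = 0) ↔
      ∃ c : ℂ, ∀ᵐ x ∂volume.restrict (Ico 0 P), ∑ k ∈ range M, u (x + k * P) = c := by
  set V : ℝ → ℂ := fun x => ∑ k ∈ range M, u (x + k * P) with hV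
  have hVL : MemLp V 2 volume := memLp_finsetSum _ fun k _ => memLp_translate hu _
  constructor
  · intro h
    set m : ℂ := (P : ℂ)⁻¹ * ∫ x in (0 : ℝ)..P, V x with hm
    set f : ℝ → ℂ := fun x => V (toIcoMod hP 0 x) - m with hf
    have hfper : Function.Periodic f P := fun x => by simp [hf]
    have hfV : ∀ x ∈ Ico 0 P, f x = V x - m := fun x hx => by
      have : toIcoMod hP 0 x = x := (toIcoMod_eq_self hP).2 (by simpa using hx)
      simp [hf, this]
    have hfVae : f =ᵐ[volume.restrict (Ioc 0 P)] fun x => V x - m := by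
      rw [← restrict_Ico_eq_restrict_Ioc]
      exact (ae_restrict_iff' measurableSet_Ico).2 (.of_forall hfV)
    have hVm : MemLp (fun x => V x - m) 2 (volume.restrict (Ioc 0 P)) :=
      (hVL.restrict _).sub (memLp_const m)
    have hfL : MemLp f 2 (volume.restrict (Ioc 0 P)) := (memLp_congr_ae hfVae).2 hVm
    have hVI : IntervalIntegrable V volume 0 P :=
      (intervalIntegrable_iff_integrableOn_Ioc_of_le hP.le).2
        ((hVL.restrict _).integrable (by norm_num))
    have hf0 : ∫ x in (0 : ℝ)..P, f x = 0 := by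
      rw [intervalIntegral.integral_of_le hP.le, integral_congr_ae hfVae,
        ← intervalIntegral.integral_of_le hP.le,
        intervalIntegral.integral_sub hVI intervalIntegrable_const,
        intervalIntegral.integral_const, hm, sub_zero, Complex.real_smul,
        mul_inv_cancel_left₀ (by exact_mod_cast hP.ne'), sub_self]
    have hfmem : f ∈ periodicSpace P := ⟨hfper, memLp_of_periodic hP hfper hfL, hf0⟩
    have hz := h f hfmem
    rw [integral_conj_mul_eq hfper hfmem.2.1 hu] at hz
    have hsq : IntegrableOn (fun x => ‖f x‖ ^ 2) (Ioc 0 P) :=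
      (memLp_two_iff_integrable_sq_norm hfL.1).1 hfL
    have hz' : ∫ x in Ioc 0 P, ‖f x‖ ^ 2 = 0 := by
      have e : ∀ᵐ x ∂volume.restrict (Ioc 0 P),
          conj (f x) * V x = ((‖f x‖ ^ 2 : ℝ) : ℂ) + m * conj (f x) := by
        filter_upwards [hfVae] with x hx
        have : V x = f x + m := by rw [hx]; ring
        rw [this, mul_add, mul_comm (conj (f x)) (f x), Complex.mul_conj,
          Complex.normSq_eq_norm_sq]
        ring
      have hsqc : IntegrableOn (fun x => ((‖f x‖ ^ 2 : ℝ) : ℂ)) (Ioc 0 P) := hsq.ofReal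
      have hcI : IntegrableOn (fun x => m * conj (f x)) (Ioc 0 P) :=
        Integrable.const_mul (hfL.star.integrable (by norm_num)) m
      rw [intervalIntegral.integral_of_le hP.le] at hz hf0
      rw [integral_congr_ae e, integral_add hsqc hcI, integral_const_mul, integral_conj,
        hf0, map_zero, mul_zero, add_zero, integral_complex_ofReal] at hz
      exact_mod_cast hz
    rw [integral_eq_zero_iff_of_nonneg (fun x => by positivity) hsq] at hz'
    refine ⟨m, ?_⟩
    rw [restrict_Ico_eq_restrict_Ioc]
    filter_upwards [hz', hfVae] with x hx hx'
    have : f x = 0 := by simpa using hx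
    rw [this] at hx'
    exact (sub_eq_zero.1 hx'.symm)
  · rintro ⟨c, hc⟩ f ⟨hf, hL, hf0⟩
    rw [integral_conj_mul_eq hf hL hu, intervalIntegral.integral_of_le hP.le]
    rw [restrict_Ico_eq_restrict_Ioc] at hc
    have e : ∀ᵐ x ∂volume.restrict (Ioc 0 P), conj (f x) * V x = conj (f x) * c := by
      filter_upwards [hc] with x hx
      rw [← hx]
    rw [integral_congr_ae e, integral_mul_const, integral_conj,
      ← intervalIntegral.integral_of_le hP.le, hf0, map_zero, zero_mul]

end Periodization

/-! ### Generating polynomials on arithmetic progressions -/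

section Fiber

open Polynomial

/-- The generating polynomial of the first `K` values of `u` on the progression `x + g ℕ`. -/
noncomputable def fiber (K : ℕ) (g : ℝ) (u : ℝ → ℂ) (x : ℝ) : ℂ[X] :=
  ∑ k ∈ range K, C (u (x + k * g)) * X ^ k

lemma coeff_fiber (K : ℕ) (g : ℝ) (u : ℝ → ℂ) (x : ℝ) (n : ℕ) :
    (fiber K g u x).coeff n = if n < K then u (x + n * g) else 0 := by
  simp [fiber, coeff_X_pow]

lemma sum_range_mul {M : Type*} [AddCommMonoid M] (f : ℕ → M) (m t : ℕ) :
    ∑ k ∈ range (m * t), f k = ∑ j ∈ range t, ∑ k ∈ range m, f (j + k * t) := by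
  rw [sum_comm]
  induction m with
  | zero => simp
  | succ m ih =>
    rw [add_mul, one_mul, sum_range_add, ih, sum_range_succ]
    simp only [add_comm]

/-- Modulo `X^t - 1` a polynomial reduces to the sums of its coefficients over residue classes. -/
lemma X_pow_sub_one_dvd_fiber_sub (t m : ℕ) (g : ℝ) (u : ℝ → ℂ) (x : ℝ) :
    (X ^ t - 1 : ℂ[X]) ∣ fiber (m * t) g u x -
      ∑ j ∈ range t, C (∑ k ∈ range m, u (x + (j + k * t : ℕ) * g)) * X ^ j := by
  rw [fiber, sum_range_mul, ← sum_sub_distrib]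
  refine dvd_sum fun j _ => ?_
  rw [map_sum, sum_mul, ← sum_sub_distrib]
  refine dvd_sum fun k _ => ?_
  rw [← mul_sub, pow_add, mul_comm k t, pow_mul, ← mul_sub_one]
  exact Dvd.dvd.mul_left (Dvd.dvd.mul_left (sub_one_dvd_pow_sub_one _ _) _) _

lemma X_pow_sub_one_dvd_sub_iff {t : ℕ} (ht : 0 < t) (F : ℂ[X]) (c : ℂ) :
    (X ^ t - 1 : ℂ[X]) ∣ F - C c * geomPoly ℂ t ↔ geomPoly ℂ t ∣ F ∧ F.eval 1 = c * t := by
  rw [← geomPoly_mul_X_sub_one]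
  constructor
  · intro h
    refine ⟨(dvd_sub_left (dvd_mul_left _ _)).1 ((dvd_mul_right _ _).trans h), ?_⟩
    have := eval_dvd (x := 1) h
    simpa [eval_one_geomPoly, sub_eq_zero] using this
  · rintro ⟨⟨s, rfl⟩, h⟩
    rw [eval_mul, eval_one_geomPoly, mul_comm] at h
    have hs := mul_right_cancel₀ (Nat.cast_ne_zero.2 ht.ne') h
    rw [mul_comm (C c), ← mul_sub]
    refine mul_dvd_mul_left _ ?_
    rw [← C_1, dvd_iff_isRoot]
    simp [hs]

/-- All the sums of `u` over the residue classes mod `t` of a progression have the same value `c`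
if and only if the generating polynomial is `c (1 + X + ⋯ + X^(t-1))` modulo `X^t - 1`. -/
lemma sum_residues_const_iff {t : ℕ} (ht : 0 < t) (m : ℕ) (g : ℝ) (u : ℝ → ℂ) (x : ℝ) (c : ℂ) :
    (∀ j < t, ∑ k ∈ range m, u (x + j * g + k * (t * g)) = c) ↔
      geomPoly ℂ t ∣ fiber (m * t) g u x ∧ (fiber (m * t) g u x).eval 1 = c * t := by
  set R : ℂ[X] := ∑ j ∈ range t, C (∑ k ∈ range m, u (x + (j + k * t : ℕ) * g)) * X ^ j with hR
  have hc (j : ℕ) : (R - C c * geomPoly ℂ t).coeff j =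
      if j < t then ∑ k ∈ range m, u (x + j * g + k * (t * g)) - c else 0 := by
    rw [coeff_sub, coeff_C_mul, coeff_geomPoly, hR]
    simp only [finsetSum_coeff, coeff_C_mul, coeff_X_pow, mul_ite, mul_one, mul_zero,
      sum_ite_eq, Finset.mem_range]
    split_ifs
    · congr 1
      refine sum_congr rfl fun k _ => congrArg u ?_
      push_cast
      ring
    · simp
  rw [← X_pow_sub_one_dvd_sub_iff ht, ← sub_add_sub_cancel (fiber (m * t) g u x) R,
    dvd_add_right (X_pow_sub_one_dvd_fiber_sub t m g u x)]
  constructor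
  · intro h
    rw [show R - C c * geomPoly ℂ t = 0 from Polynomial.ext fun j => ?_]
    · exact dvd_zero _
    · rw [hc, coeff_zero]
      split_ifs with hj
      · rw [h j hj, sub_self]
      · rfl
  · intro h j hj
    have h0 : R - C c * geomPoly ℂ t = 0 := by
      refine eq_zero_of_dvd_of_degree_lt h ?_
      rw [← C_1, degree_X_pow_sub_C ht, degree_lt_iff_coeff_zero]
      intro j hj
      rw [hc, if_neg (by omega)]
    have := hc j
    rw [h0, coeff_zero, if_pos hj] at this
    exact sub_eq_zero.1 this.symm

end Fiber

/-! ### Almost everywhere statements and translations -/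

section AlmostEverywhere

lemma ae_restrict_Ico_add_iff {p : ℝ → Prop} (a b s : ℝ) :
    (∀ᵐ x ∂volume.restrict (Ico a b), p (x + s)) ↔
      ∀ᵐ x ∂volume.restrict (Ico (a + s) (b + s)), p x := by
  have h := (measurePreserving_add_right volume s).restrict_preimage_emb
    (measurableEmbedding_addRight s) (Ico (a + s) (b + s))
  rw [preimage_add_const_Ico, add_sub_cancel_right, add_sub_cancel_right] at h
  rw [← h.map_eq, (measurableEmbedding_addRight s).ae_map_iff]

lemma ae_restrict_Ico_mul_iff {p : ℝ → Prop} {g : ℝ} (hg : 0 < g) (t : ℕ) :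
    (∀ᵐ x ∂volume.restrict (Ico 0 (t * g)), p x) ↔
      ∀ j < t, ∀ᵐ x ∂volume.restrict (Ico 0 g), p (x + j * g) := by
  induction t with
  | zero => simp
  | succ t ih =>
    have : Ico 0 (((t + 1 : ℕ) : ℝ) * g) = Ico 0 (t * g) ∪ Ico (0 + t * g) (g + t * g) := by
      rw [zero_add, Set.Ico_union_Ico_eq_Ico (by positivity) (by linarith)]
      push_cast
      ring_nf
    rw [this, ae_restrict_union_iff, ih, ← ae_restrict_Ico_add_iff, Nat.forall_lt_succ_right]

lemma ae_of_ae_restrict_Ico {p : ℝ → Prop} {g : ℝ} (hg : 0 < g) (hneg : ∀ x < 0, p x)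
    (h : ∀ᵐ x ∂volume.restrict (Ico 0 g), ∀ k : ℕ, p (x + k * g)) : ∀ᵐ x, p x := by
  have hn (n : ℕ) : ∀ᵐ x ∂volume.restrict (Ico 0 (n * g)), p x :=
    (ae_restrict_Ico_mul_iff hg n).2 fun j _ => h.mono fun x hx => hx j
  have h2 := (ae_restrict_iUnion_iff (μ := volume) (fun n : ℕ => Ico 0 (n * g)) p).2 hn
  have h3 : ⋃ n : ℕ, Ico 0 (n * g) = Ici (0 : ℝ) := by
    ext x
    simp only [mem_iUnion, Set.mem_Ico, Set.mem_Ici]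
    refine ⟨fun ⟨n, hx, _⟩ => hx, fun hx => ?_⟩
    obtain ⟨n, hn⟩ := exists_nat_gt (x / g)
    exact ⟨n, hx, (div_lt_iff₀ hg).1 hn⟩
  rw [h3, ae_restrict_iff' measurableSet_Ici] at h2
  filter_upwards [h2] with x hx
  exact (lt_or_ge x 0).elim (hneg x) hx

end AlmostEverywhere

/-! ### Step functions -/

section StepFunction

open Polynomial

/-- The step function with the value `Q.coeff k` on `[k g, (k + 1) g)` for all `k ≥ 0`, which
vanishes on the negative half line. -/
noncomputable def stepFn (g : ℝ) (Q : ℝ[X]) (t : ℝ) : ℝ :=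
  if 0 ≤ t then Q.coeff ⌊t / g⌋₊ else 0

variable {g : ℝ}

lemma stepFn_add_mul (hg : 0 < g) (Q : ℝ[X]) {x : ℝ} (hx : x ∈ Ico 0 g) (k : ℕ) :
    stepFn g Q (x + k * g) = Q.coeff k := by
  have hx0 := hx.1
  rw [stepFn, if_pos (by positivity), add_div, mul_div_cancel_right₀ _ hg.ne',
    Nat.floor_add_natCast (by positivity), Nat.floor_eq_zero.2 ((div_lt_one hg).2 hx.2), zero_add]

lemma stepFn_of_neg (Q : ℝ[X]) {x : ℝ} (hx : x < 0) : stepFn g Q x = 0 := if_neg hx.not_ge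

lemma stepFn_of_ge (hg : 0 < g) (Q : ℝ[X]) {x : ℝ} (hx : (Q.natDegree + 1) * g ≤ x) :
    stepFn g Q x = 0 := by
  rw [stepFn, coeff_eq_zero_of_natDegree_lt, ite_self]
  rw [← Nat.succ_le_iff]
  exact Nat.le_floor (by rw [le_div_iff₀ hg]; exact_mod_cast hx)

lemma stepFn_last (hg : 0 < g) (Q : ℝ[X]) {x : ℝ} (h1 : Q.natDegree * g ≤ x)
    (h2 : x < (Q.natDegree + 1) * g) : stepFn g Q x = Q.leadingCoeff := by
  rw [← sub_add_cancel x (Q.natDegree * g), stepFn_add_mul hg]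
  · rfl
  · exact ⟨by linarith, by linarith⟩

lemma measurable_stepFn (Q : ℝ[X]) : Measurable (stepFn g Q) := by
  refine Measurable.ite measurableSet_Ici ?_ measurable_const
  exact (measurable_from_nat (f := fun n => Q.coeff n)).comp
    (Nat.measurable_floor.comp (measurable_id.div_const g))

lemma memLp_stepFn (hg : 0 < g) (Q : ℝ[X]) :
    MemLp (fun t => (stepFn g Q t : ℂ)) 2 volume := by
  have hm : Measurable fun t => (stepFn g Q t : ℂ) :=
    Complex.measurable_ofReal.comp (measurable_stepFn Q)
  have e : (fun t => (stepFn g Q t : ℂ)) =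
      (Ico 0 ((Q.natDegree + 1) * g)).indicator fun t => (stepFn g Q t : ℂ) := by
    refine (indicator_eq_self.2 fun t ht => ?_).symm
    by_contra h
    rw [Set.mem_Ico, not_and_or, not_le, not_lt] at h
    refine ht ?_
    rcases h with h | h
    · simp [stepFn_of_neg Q h]
    · simp [stepFn_of_ge hg Q h]
  rw [e, memLp_indicator_iff_restrict measurableSet_Ico]
  obtain ⟨B, hB⟩ := (Set.finite_range fun k : Fin (Q.natDegree + 1) => |Q.coeff k|).bddAbove
  refine MemLp.of_bound hm.aestronglyMeasurable (max B 0) (.of_forall fun t => ?_)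
  rw [Complex.norm_real, Real.norm_eq_abs, stepFn]
  split_ifs
  · rcases lt_or_ge ⌊t / g⌋₊ (Q.natDegree + 1) with h | h
    · exact le_max_of_le_left (hB ⟨⟨_, h⟩, rfl⟩)
    · rw [coeff_eq_zero_of_natDegree_lt (by omega), abs_zero]
      exact le_max_right _ _
  · simp

end StepFunction

end PosOrth

namespace PosOrth

open MeasureTheory Set Finset Polynomial
open scoped ComplexConjugate

/-! ### Orthogonality in terms of divisibility of polynomials -/

section Orthogonality

/-- `Q` is, up to a scalar, the least common multiple of the polynomials `1 + X + ⋯ + X^(t i - 1)`;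
divisibility is tested over `ℂ`, where the generating polynomials of functions live. -/
structure IsStepPoly {n : ℕ} (t : Fin n → ℕ) (Q : ℝ[X]) : Prop where
  pos : ∀ i, 0 < t i
  dvd_iff : ∀ p : ℂ[X], Q.map (algebraMap ℝ ℂ) ∣ p ↔ ∀ i, geomPoly ℂ (t i) ∣ p
  eval_one_ne_zero : Q.eval 1 ≠ 0

lemma IsStepPoly.ne_zero {n : ℕ} {t : Fin n → ℕ} {Q : ℝ[X]} (hQ : IsStepPoly t Q) : Q ≠ 0 := by
  rintro rfl
  exact hQ.eval_one_ne_zero eval_zero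

/-- Orthogonality of `u` to the `t g`-periodic functions of mean zero, on almost every
progression of step `g`. The value `c` of the generating polynomial at `1` is the sum of `u` over
the progression, which does not depend on the progression. -/
lemma forall_periodicSpace_iff_fiber {t m : ℕ} (ht : 0 < t) {g : ℝ} (hg : 0 < g) {u : ℝ → ℂ}
    (hu : MemLp u 2 volume) :
    (∀ f ∈ periodicSpace (t * g), ∫ x in (0 : ℝ)..(m * t : ℕ) * g, conj (f x) * u x = 0) ↔
      ∃ c : ℂ, ∀ᵐ x ∂volume.restrict (Ico 0 g),
        geomPoly ℂ t ∣ fiber (m * t) g u x ∧ (fiber (m * t) g u x).eval 1 = c := by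
  have ht0 : (t : ℂ) ≠ 0 := Nat.cast_ne_zero.2 ht.ne'
  have key (c : ℂ) : (∀ᵐ x ∂volume.restrict (Ico 0 (t * g)),
      ∑ k ∈ range m, u (x + k * (t * g)) = c) ↔ ∀ᵐ x ∂volume.restrict (Ico 0 g),
        geomPoly ℂ t ∣ fiber (m * t) g u x ∧ (fiber (m * t) g u x).eval 1 = c * t := by
    rw [ae_restrict_Ico_mul_iff hg]
    simp_rw [← sum_residues_const_iff ht, ae_all_iff]
  rw [Nat.cast_mul, mul_assoc, forall_periodicSpace_iff (by positivity) hu]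
  constructor
  · rintro ⟨c, hc⟩
    exact ⟨c * t, (key c).1 hc⟩
  · rintro ⟨c, hc⟩
    exact ⟨c / t, (key _).2 (by rwa [div_mul_cancel₀ _ ht0])⟩

variable {n : ℕ} {t : Fin n → ℕ} {Q : ℝ[X]} {g : ℝ}

lemma IsStepPoly.forall_periodicSpace_iff [NeZero n] (hQ : IsStepPoly t Q) (hg : 0 < g)
    {u : ℝ → ℂ} (hu : MemLp u 2 volume) {K : ℕ} (hK : ∀ i, t i ∣ K) :
    (∀ i, ∀ f ∈ periodicSpace (t i * g), ∫ x in (0 : ℝ)..K * g, conj (f x) * u x = 0) ↔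
      ∃ c : ℂ, ∀ᵐ x ∂volume.restrict (Ico 0 g),
        Q.map (algebraMap ℝ ℂ) ∣ fiber K g u x ∧ (fiber K g u x).eval 1 = c := by
  have key (i : Fin n) :
      (∀ f ∈ periodicSpace (t i * g), ∫ x in (0 : ℝ)..K * g, conj (f x) * u x = 0) ↔
      ∃ c : ℂ, ∀ᵐ x ∂volume.restrict (Ico 0 g),
        geomPoly ℂ (t i) ∣ fiber K g u x ∧ (fiber K g u x).eval 1 = c := by
    obtain ⟨m, hm⟩ := hK i
    rw [mul_comm] at hm
    rw [hm]
    exact forall_periodicSpace_iff_fiber (hQ.pos i) hg hu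
  simp_rw [key, hQ.dvd_iff]
  constructor
  · intro h
    choose c hc using h
    refine ⟨c 0, ?_⟩
    filter_upwards [ae_all_iff.2 hc] with x hx
    exact ⟨fun i => (hx i).1, (hx 0).2⟩
  · rintro ⟨c, hc⟩ i
    exact ⟨c, hc.mono fun x hx => ⟨hx.1 i, hx.2⟩⟩

/-- If the support of `u` is short, its generating polynomials have degree at most `deg Q`, so
that divisibility by `Q` makes them multiples of `Q`; the common value at `1` makes the factor
independent of the fiber. -/
lemma IsStepPoly.exists_ae_eq [NeZero n] (hQ : IsStepPoly t Q) (hg : 0 < g)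
    {u : ℝ → ℂ} (hu : MemLp u 2 volume) {K : ℕ} (hK : ∀ i, t i ∣ K) (hneg : ∀ x < 0, u x = 0)
    (hKu : ∀ x, K * g ≤ x → u x = 0) (hQu : ∀ x, (Q.natDegree + 1) * g ≤ x → u x = 0)
    (h : ∀ i, ∀ f ∈ periodicSpace (t i * g), ∫ x in (0 : ℝ)..K * g, conj (f x) * u x = 0) :
    ∃ c : ℂ, ∀ᵐ x, u x = c * stepFn g Q x := by
  obtain ⟨c, hc⟩ := (hQ.forall_periodicSpace_iff hg hu hK).1 h
  set Q' : ℂ[X] := Q.map (algebraMap ℝ ℂ) with hQ'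
  have hQ0 : Q' ≠ 0 := (Polynomial.map_ne_zero_iff (algebraMap ℝ ℂ).injective).2 hQ.ne_zero
  have h1 : Q'.eval 1 ≠ 0 := by
    rw [hQ', eval_one_map]
    exact (_root_.map_ne_zero _).2 hQ.eval_one_ne_zero
  refine ⟨c / Q'.eval 1, ae_of_ae_restrict_Ico hg (fun x hx => ?_) ?_⟩
  · rw [hneg x hx, stepFn_of_neg Q hx, Complex.ofReal_zero, mul_zero]
  filter_upwards [hc, ae_restrict_mem measurableSet_Ico] with x ⟨⟨s, hs⟩, hx1⟩ hx k
  have hcoeff (k : ℕ) : (fiber K g u x).coeff k = u (x + k * g) := by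
    rw [coeff_fiber]
    split_ifs with hk
    · rfl
    · refine (hKu _ ?_).symm
      have : (K : ℝ) ≤ k := by exact_mod_cast not_lt.1 hk
      nlinarith [hx.1]
  have hdeg : (fiber K g u x).natDegree ≤ Q'.natDegree := by
    rw [natDegree_le_iff_coeff_eq_zero]
    intro k hk
    rw [hcoeff]
    refine hQu _ ?_
    rw [hQ', natDegree_map] at hk
    have : (Q.natDegree : ℝ) + 1 ≤ k := by exact_mod_cast hk
    nlinarith [hx.1]
  have hs0 : s = C (s.coeff 0) := by
    rcases eq_or_ne s 0 with rfl | hsne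
    · simp
    · rw [hs, natDegree_mul hQ0 hsne] at hdeg
      exact eq_C_of_natDegree_eq_zero (by omega)
  have hsc : s.coeff 0 = c / Q'.eval 1 := by
    rw [eq_div_iff h1, ← hx1, hs, eval_mul, hs0, eval_C, coeff_C_zero, mul_comm]
  rw [← hcoeff, hs, hs0, coeff_mul_C, hsc, stepFn_add_mul hg Q hx, mul_comm, hQ', coeff_map]
  rfl

lemma fiber_stepFn (hg : 0 < g) {x : ℝ} (hx : x ∈ Ico 0 g) {K : ℕ} (hK : Q.natDegree < K) :
    fiber K g (fun x => (stepFn g Q x : ℂ)) x = Q.map (algebraMap ℝ ℂ) := by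
  ext k
  rw [coeff_fiber, coeff_map, stepFn_add_mul hg Q hx]
  split_ifs with h
  · rfl
  · rw [coeff_eq_zero_of_natDegree_lt (by omega), map_zero]

lemma IsStepPoly.integral_stepFn_eq_zero [NeZero n] (hQ : IsStepPoly t Q) (hg : 0 < g) {K : ℕ}
    (hK : ∀ i, t i ∣ K) (hQK : Q.natDegree < K) (i : Fin n) {f : ℝ → ℂ}
    (hf : f ∈ periodicSpace (t i * g)) :
    ∫ x in (0 : ℝ)..K * g, conj (f x) * (stepFn g Q x : ℂ) = 0 := by
  refine (hQ.forall_periodicSpace_iff hg (memLp_stepFn hg Q) hK).2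
    ⟨(Q.map (algebraMap ℝ ℂ)).eval 1, ?_⟩ i f hf
  filter_upwards [ae_restrict_mem measurableSet_Ico] with x hx
  rw [fiber_stepFn hg hx hQK]
  exact ⟨dvd_rfl, rfl⟩

lemma IsStepPoly.exists_multiple (hQ : IsStepPoly t Q) (hg : 0 < g) (S : ℝ) :
    ∃ K : ℕ, (∀ i, t i ∣ K) ∧ S ≤ K * g ∧ Q.natDegree < K := by
  have hp : 1 ≤ ∏ i, t i := Nat.one_le_iff_ne_zero.2 (prod_ne_zero_iff.2 fun i _ => (hQ.pos i).ne')
  refine ⟨(⌈S / g⌉₊ + Q.natDegree + 1) * ∏ i, t i,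
    fun i => (dvd_prod_of_mem t (mem_univ i)).mul_left _, ?_, ?_⟩
  · rw [← div_le_iff₀ hg]
    refine (Nat.le_ceil _).trans ?_
    exact_mod_cast (by nlinarith : ⌈S / g⌉₊ ≤ (⌈S / g⌉₊ + Q.natDegree + 1) * ∏ i, t i)
  · nlinarith

lemma setIntegral_Ioo_eq {S b : ℝ} (hS : 0 < S) (hb : S ≤ b) {F : ℝ → ℂ}
    (hF : ∀ x, S ≤ x → F x = 0) : ∫ x in Ioo 0 S, F x = ∫ x in (0 : ℝ)..b, F x := by
  rw [intervalIntegral.integral_of_le (hS.le.trans hb)]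
  refine (setIntegral_eq_of_subset_of_forall_sdiff_eq_zero measurableSet_Ioc
    (fun x hx => ⟨hx.1, hx.2.le.trans hb⟩) fun x hx => hF x ?_).symm
  by_contra h
  exact hx.2 ⟨hx.1.1, not_le.1 h⟩

end Orthogonality

/-! ### The orthogonal complement in `L²(0,S)` -/

section HilbertSpace

variable {n : ℕ}

lemma inner_eq_of_ae_eq {S : ℝ} {w v : L2 S} {f : ℝ → ℂ}
    (h : w =ᵐ[volume.restrict (Ioo (0 : ℝ) S)] f) :
    inner ℂ w v = ∫ x in Ioo 0 S, conj (f x) * v x := by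
  rw [L2.inner_def]
  refine integral_congr_ae ?_
  filter_upwards [h] with x hx
  rw [RCLike.inner_apply, hx, mul_comm]

lemma mem_orthogonal_restricted_iff {τ : Fin n → ℝ} {S : ℝ} (v : L2 S) :
    v ∈ (restricted (sumSpace τ) S)ᗮ ↔
      ∀ i, ∀ f ∈ periodicSpace (τ i), ∫ x in Ioo 0 S, conj (f x) * v x = 0 := by
  rw [Submodule.mem_orthogonal]
  constructor
  · intro h i f hf
    have hL : MemLp f 2 (volume.restrict (Ioo 0 S)) :=
      (hf.2.1 0 S).mono_measure (Measure.restrict_mono Set.Ioo_subset_Icc_self le_rfl)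
    rw [← inner_eq_of_ae_eq hL.coeFn_toLp]
    exact h _ ⟨f, le_iSup (fun i => periodicSpace (τ i)) i hf, hL.coeFn_toLp⟩
  · rintro h w ⟨f, hf, hw⟩
    rw [inner_eq_of_ae_eq hw]
    have hv (f : ℝ → ℂ) (hL : MemLp f 2 (volume.restrict (Ioo 0 S))) :
        Integrable (fun x => conj (f x) * v x) (volume.restrict (Ioo 0 S)) :=
      MemLp.integrable_mul hL.star (Lp.memLp v)
    suffices MemLp f 2 (volume.restrict (Ioo 0 S)) ∧ ∫ x in Ioo 0 S, conj (f x) * v x = 0 from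
      this.2
    refine Submodule.iSup_induction (fun i => periodicSpace (τ i))
      (motive := fun f => MemLp f 2 (volume.restrict (Ioo 0 S)) ∧
        ∫ x in Ioo 0 S, conj (f x) * v x = 0) hf (fun i f hf => ⟨?_, h i f hf⟩) ?_ ?_
    · exact (hf.2.1 0 S).mono_measure (Measure.restrict_mono Set.Ioo_subset_Icc_self le_rfl)
    · simp
    · rintro f₁ f₂ ⟨hL₁, h₁⟩ ⟨hL₂, h₂⟩
      refine ⟨hL₁.add hL₂, ?_⟩
      simp_rw [Pi.add_apply, map_add, add_mul]
      rw [integral_add (hv _ hL₁) (hv _ hL₂), h₁, h₂, add_zero]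

lemma IsCriticalLength.unique {τ : Fin n → ℝ} {S T : ℝ} (hS : IsCriticalLength τ S)
    (hT : IsCriticalLength τ T) : S = T := by
  have key {S T : ℝ} (hS : IsCriticalLength τ S) (hT : IsCriticalLength τ T) : T ≤ S := by
    by_contra! h
    obtain ⟨R, h1, h2⟩ := exists_between h
    exact hS.2.2 R h1 (hT.2.1 R (hS.1.trans h1) h2)
  exact (key hT hS).antisymm (key hS hT)

lemma exists_mem_Ioo_of_ae {p : ℝ → Prop} (h : ∀ᵐ x, p x) {a b : ℝ} (hab : a < b) :
    ∃ x, p x ∧ x ∈ Ioo a b :=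
  (Measure.dense_of_ae h).exists_between hab

end HilbertSpace

/-! ### Critical length and orthogonal functions of commensurable periods -/

section CriticalLength

variable {n : ℕ} [NeZero n] {t : Fin n → ℕ} {τ : Fin n → ℝ} {Q : ℝ[X]} {g : ℝ}

lemma IsStepPoly.ae_eq_of_mem_orthogonal (hQ : IsStepPoly t Q) (hg : 0 < g)
    (hτ : ∀ i, τ i = t i * g) {S : ℝ} (hS : 0 < S) (hST : S ≤ (Q.natDegree + 1) * g) {v : L2 S}
    (hv : v ∈ (restricted (sumSpace τ) S)ᗮ) :
    ∃ c : ℂ, ∀ᵐ x, (Ioo 0 S).indicator v x = c * stepFn g Q x := by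
  obtain ⟨K, hK, hSK, -⟩ := hQ.exists_multiple hg S
  have h0 (x : ℝ) (hx : S ≤ x) : (Ioo 0 S).indicator v x = 0 :=
    indicator_of_notMem (fun h => h.2.not_ge hx) _
  refine hQ.exists_ae_eq hg ((memLp_indicator_iff_restrict measurableSet_Ioo).2 (Lp.memLp v)) hK
    (fun x hx => indicator_of_notMem (fun h => h.1.not_gt hx) _)
    (fun x hx => h0 x (hSK.trans hx)) (fun x hx => h0 x (hST.trans hx)) fun i f hf => ?_
  rw [← setIntegral_Ioo_eq hS hSK fun x hx => by rw [h0 x hx, mul_zero]]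
  rw [← (mem_orthogonal_restricted_iff v).1 hv i f (by rwa [hτ])]
  refine setIntegral_congr_fun measurableSet_Ioo fun x hx => ?_
  simp only [indicator_of_mem hx]

lemma IsStepPoly.stepFn_mem_orthogonal (hQ : IsStepPoly t Q) (hg : 0 < g)
    (hτ : ∀ i, τ i = t i * g) {S : ℝ} (hST : (Q.natDegree + 1) * g ≤ S) :
    ((memLp_stepFn hg Q).restrict (Ioo 0 S)).toLp ∈ (restricted (sumSpace τ) S)ᗮ := by
  rw [mem_orthogonal_restricted_iff]
  intro i f hf
  obtain ⟨K, hK, hSK, hQK⟩ := hQ.exists_multiple hg S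
  have hS : 0 < S := lt_of_lt_of_le (by positivity) hST
  rw [hτ] at hf
  rw [← hQ.integral_stepFn_eq_zero hg hK hQK i hf, ← setIntegral_Ioo_eq hS hSK fun x hx => by
    rw [stepFn_of_ge hg Q (hST.trans hx), Complex.ofReal_zero, mul_zero]]
  refine integral_congr_ae ?_
  filter_upwards [((memLp_stepFn hg Q).restrict (Ioo 0 S)).coeFn_toLp] with x hx
  rw [hx]

/-- Below the length `(deg Q + 1) g` a multiple of the step function of `Q` that vanishes beyond
`S` must be zero, because `Q` has a nonzero leading coefficient; above it the step function itself
is a nonzero element of the orthogonal complement. -/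
lemma IsStepPoly.isCriticalLength (hQ : IsStepPoly t Q) (hg : 0 < g) (hτ : ∀ i, τ i = t i * g) :
    IsCriticalLength τ ((Q.natDegree + 1) * g) := by
  have hlc : (Q.leadingCoeff : ℂ) ≠ 0 := by
    exact_mod_cast leadingCoeff_ne_zero.2 hQ.ne_zero
  have hlt : (Q.natDegree : ℝ) * g < (Q.natDegree + 1) * g := by linarith
  have hD : (0 : ℝ) ≤ Q.natDegree * g := by positivity
  refine ⟨by positivity, fun S hS hST => ?_, fun S hS h => ?_⟩
  · rw [Submodule.topologicalClosure_eq_top_iff, eq_bot_iff]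
    intro v hv
    obtain ⟨c, hc⟩ := hQ.ae_eq_of_mem_orthogonal hg hτ hS hST.le hv
    obtain ⟨x, hx, hx1, hx2⟩ := exists_mem_Ioo_of_ae hc (max_lt hST hlt)
    rw [max_lt_iff] at hx1
    rw [indicator_of_notMem fun h => h.2.not_gt hx1.1, stepFn_last hg Q hx1.2.le hx2, eq_comm,
      mul_eq_zero] at hx
    have hc0 := hx.resolve_right hlc
    rw [Submodule.mem_bot]
    refine Lp.ext ?_
    filter_upwards [ae_restrict_of_ae hc, ae_restrict_mem measurableSet_Ioo,
      Lp.coeFn_zero ℂ 2 (volume.restrict (Ioo (0 : ℝ) S))] with x hx hxm hx0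
    rw [indicator_of_mem hxm, hc0, zero_mul] at hx
    rw [hx, hx0, Pi.zero_apply]
  · rw [Submodule.topologicalClosure_eq_top_iff] at h
    have hm := hQ.stepFn_mem_orthogonal hg hτ hS.le
    rw [h, Submodule.mem_bot] at hm
    have h1 := ((memLp_stepFn hg Q).restrict (Ioo 0 S)).coeFn_toLp
    rw [hm] at h1
    have h2 := h1.symm.trans (Lp.coeFn_zero ℂ 2 (volume.restrict (Ioo (0 : ℝ) S)))
    obtain ⟨x, hx, hx1, hx2⟩ := exists_mem_Ioo_of_ae
      ((ae_restrict_iff' measurableSet_Ioo).1 h2) hlt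
    have : (stepFn g Q x : ℂ) = 0 := hx ⟨hD.trans_lt hx1, hx2.trans hS⟩
    rw [stepFn_last hg Q hx1.le hx2] at this
    exact hlc this

/-- The orthogonal functions are exactly the nonzero real multiples of one step function. -/
lemma IsStepPoly.isOrthogonalFunction_iff (hQ : IsStepPoly t Q) (hg : 0 < g)
    (hτ : ∀ i, τ i = t i * g) (h : ℝ → ℝ) :
    IsOrthogonalFunction τ h ↔ ∃ c : ℝ, c ≠ 0 ∧ ∀ᵐ x, h x = c * stepFn g Q x := by
  have hcrit := hQ.isCriticalLength hg hτ
  have hlc : (Q.leadingCoeff : ℂ) ≠ 0 := by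
    exact_mod_cast leadingCoeff_ne_zero.2 hQ.ne_zero
  have hlt : (Q.natDegree : ℝ) * g < (Q.natDegree + 1) * g := by linarith
  have hD : (0 : ℝ) ≤ Q.natDegree * g := by positivity
  constructor
  · rintro ⟨T, hT, h0, hL, hcl⟩
    obtain rfl := hT.unique hcrit
    have horth : (restricted (sumSpace τ) ((Q.natDegree + 1) * g))ᗮ =
        Submodule.span ℂ {hL.toLp} := by
      rw [← Submodule.orthogonal_closure, hcl, Submodule.orthogonal_orthogonal]
    have hm := hQ.stepFn_mem_orthogonal hg hτ le_rfl
    rw [horth, Submodule.mem_span_singleton] at hm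
    obtain ⟨a, ha⟩ := hm
    have hae : ∀ᵐ x, x ∈ Ioo 0 ((Q.natDegree + 1) * g) → (stepFn g Q x : ℂ) = a * h x := by
      rw [← ae_restrict_iff' measurableSet_Ioo]
      have h1 := ((memLp_stepFn hg Q).restrict (Ioo 0 ((Q.natDegree + 1) * g))).coeFn_toLp
      rw [← ha] at h1
      filter_upwards [h1, Lp.coeFn_smul a hL.toLp, hL.coeFn_toLp] with x h1 h2 h3
      rw [← h1, h2, Pi.smul_apply, h3, smul_eq_mul]
    obtain ⟨y, hy, hy1, hy2⟩ := exists_mem_Ioo_of_ae hae hlt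
    have hy := hy ⟨hD.trans_lt hy1, hy2⟩
    rw [stepFn_last hg Q hy1.le hy2] at hy
    have hhy : h y ≠ 0 := by
      intro h0
      rw [h0, Complex.ofReal_zero, mul_zero] at hy
      exact hlc hy
    -- the scalar is real because it is a quotient of two real values
    have har : a = ((Q.leadingCoeff / h y : ℝ) : ℂ) := by
      rw [Complex.ofReal_div, eq_div_iff (by exact_mod_cast hhy), hy]
    have hlr : Q.leadingCoeff ≠ 0 := leadingCoeff_ne_zero.2 hQ.ne_zero
    refine ⟨(Q.leadingCoeff / h y)⁻¹, inv_ne_zero (div_ne_zero hlr hhy), ?_⟩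
    filter_upwards [h0, hae, (measure_eq_zero_iff_ae_notMem.1 (Real.volume_singleton (a := 0)))]
      with x h0 hx hx0
    by_cases hxm : x ∈ Ioo 0 ((Q.natDegree + 1) * g)
    · have := hx hxm
      rw [har] at this
      norm_cast at this
      rw [this, inv_mul_cancel_left₀ (div_ne_zero hlr hhy)]
    · rw [h0 hxm]
      rcases lt_or_ge x 0 with hn | hn
      · rw [stepFn_of_neg Q hn, mul_zero]
      · rw [stepFn_of_ge hg Q, mul_zero]
        by_contra! hlt
        exact hxm ⟨lt_of_le_of_ne hn (Ne.symm hx0), hlt⟩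
  · rintro ⟨c, hc, hae⟩
    have hcC : (c : ℂ) ≠ 0 := by exact_mod_cast hc
    have haeC : ∀ᵐ x, (h x : ℂ) = c * stepFn g Q x := by
      filter_upwards [hae] with x hx
      rw [hx, Complex.ofReal_mul]
    have hL : MemLp (fun x => (h x : ℂ)) 2
        (volume.restrict (Ioo 0 ((Q.natDegree + 1) * g))) :=
      ((memLp_congr_ae haeC).2 ((memLp_stepFn hg Q).const_mul _)).restrict _
    refine ⟨_, hcrit, ?_, hL, ?_⟩
    · filter_upwards [hae, (measure_eq_zero_iff_ae_notMem.1 (Real.volume_singleton (a := 0)))]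
        with x hx hx0 hxm
      rw [hx]
      rcases lt_or_ge x 0 with hn | hn
      · rw [stepFn_of_neg Q hn, mul_zero]
      · rw [stepFn_of_ge hg Q, mul_zero]
        by_contra! hlt
        exact hxm ⟨lt_of_le_of_ne hn (Ne.symm hx0), hlt⟩
    · rw [← Submodule.orthogonal_orthogonal_eq_closure]
      congr 1
      apply le_antisymm
      · intro v hv
        obtain ⟨b, hb⟩ := hQ.ae_eq_of_mem_orthogonal hg hτ hcrit.1 le_rfl hv
        refine Submodule.mem_span_singleton.2 ⟨b / c, Lp.ext ?_⟩
        filter_upwards [Lp.coeFn_smul (b / (c : ℂ)) hL.toLp, hL.coeFn_toLp, ae_restrict_of_ae hb,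
          ae_restrict_of_ae haeC, ae_restrict_mem measurableSet_Ioo] with x h1 h2 h3 h4 h5
        rw [indicator_of_mem h5] at h3
        rw [h1, Pi.smul_apply, h2, h3, h4, smul_eq_mul, ← mul_assoc, div_mul_cancel₀ _ hcC]
      · rw [Submodule.span_singleton_le_iff_mem]
        have e : hL.toLp = (c : ℂ) • ((memLp_stepFn hg Q).restrict _).toLp := by
          rw [← MemLp.toLp_const_smul]
          exact MemLp.toLp_congr _ _ (ae_restrict_of_ae haeC)
        rw [e]
        exact Submodule.smul_mem _ _ (hQ.stepFn_mem_orthogonal hg hτ le_rfl)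

end CriticalLength

/-! ### Products of polynomials and sums of shifted step functions -/

section Shift

variable {g : ℝ}

lemma stepFn_sum {ι : Type*} (s : Finset ι) (P : ι → ℝ[X]) (x : ℝ) :
    stepFn g (∑ i ∈ s, P i) x = ∑ i ∈ s, stepFn g (P i) x := by
  simp only [stepFn, finsetSum_coeff]
  split_ifs <;> simp

lemma stepFn_mul_C (Q : ℝ[X]) (a x : ℝ) : stepFn g (Q * C a) x = a * stepFn g Q x := by
  simp only [stepFn, coeff_mul_C]
  split_ifs <;> simp [mul_comm]

lemma stepFn_mul_X_pow (hg : 0 < g) (Q : ℝ[X]) (j : ℕ) (x : ℝ) :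
    stepFn g (Q * X ^ j) x = stepFn g Q (x - j * g) := by
  simp only [stepFn, coeff_mul_X_pow', sub_div, mul_div_cancel_right₀ _ hg.ne',
    Nat.floor_sub_natCast]
  rcases lt_or_ge x 0 with hx | hx
  · rw [if_neg hx.not_ge, if_neg (by have : 0 ≤ j * g := by positivity
                                     linarith)]
  · have : 0 ≤ x - j * g ↔ j ≤ ⌊x / g⌋₊ := by
      rw [Nat.le_floor_iff (by positivity), le_div_iff₀ hg, sub_nonneg]
    simp only [if_pos hx, this]

lemma stepFn_mul (hg : 0 < g) (Q A : ℝ[X]) (x : ℝ) :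
    stepFn g (Q * A) x =
      ∑ j ∈ range (A.natDegree + 1), A.coeff j * stepFn g Q (x - j * g) := by
  conv_lhs => rw [A.as_sum_range_C_mul_X_pow]
  rw [mul_sum, stepFn_sum]
  refine sum_congr rfl fun j _ => ?_
  rw [← mul_assoc, stepFn_mul_X_pow hg, stepFn_mul_C]

lemma stepFn_geomPoly (hg : 0 < g) (t : ℕ) (x : ℝ) :
    stepFn g (geomPoly ℝ t) x = (Ico (0 : ℝ) (t * g)).indicator 1 x := by
  rw [stepFn, coeff_geomPoly, Set.indicator_apply]
  by_cases hx : 0 ≤ x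
  · simp [hx, Nat.floor_lt (show 0 ≤ x / g by positivity), div_lt_iff₀ hg]
  · simp [hx]

/-- The two factors in the definition of `pairPoly` correspond to the indicator function and to
the sum of its shifts in the definition of `h2`. -/
lemma h2_eq_stepFn {g : ℕ} (hg : 0 < g) (t₁ t₂ : ℕ) :
    h2 (t₁ * g) (t₂ * g) = stepFn g (pairPoly ℝ t₁ t₂) := by
  have hg' : (0 : ℝ) < g := Nat.cast_pos.2 hg
  funext x
  rw [h2, pairPoly, mul_sum, stepFn_sum, Nat.gcd_mul_right, Nat.mul_div_mul_right _ _ hg]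
  refine sum_congr rfl fun j _ => ?_
  rw [stepFn_mul_X_pow hg', stepFn_geomPoly hg', h1]
  push_cast
  rw [mul_assoc]

end Shift

/-! ### Two and three periods -/

section Periods

lemma isStepPoly_pair {t₁ t₂ : ℕ} (h₁ : 0 < t₁) (h₂ : 0 < t₂) :
    IsStepPoly ![t₁, t₂] (pairPoly ℝ t₁ t₂) where
  pos i := by fin_cases i <;> assumption
  dvd_iff p := by simp [pairPoly_dvd_iff h₂, Fin.forall_fin_two]
  eval_one_ne_zero := by
    rw [eval_one_pairPoly]
    have := Nat.div_pos (Nat.gcd_le_right t₁ h₂) (Nat.gcd_pos_of_pos_right _ h₂)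
    positivity

lemma isStepPoly_triple {t₁ t₂ t₃ : ℕ} (h₁ : 0 < t₁) (h₂ : 0 < t₂) (h₃ : 0 < t₃)
    (hcop : (t₁.gcd t₃).Coprime (t₂.gcd t₃)) {A : ℝ[X]}
    (hA : A * (geomPoly ℝ (t₁.gcd t₃) * geomPoly ℝ (t₂.gcd t₃)) = geomPoly ℝ t₃) :
    IsStepPoly ![t₁, t₂, t₃] (pairPoly ℝ t₁ t₂ * A) where
  pos i := by fin_cases i <;> assumption
  dvd_iff p := by
    have hA' := congrArg (Polynomial.map (algebraMap ℝ ℂ)) hA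
    simp only [Polynomial.map_mul, map_geomPoly] at hA'
    rw [Polynomial.map_mul, map_pairPoly, pairPoly_mul_dvd_iff h₁ h₂ h₃ hcop hA']
    simp [Fin.forall_fin_succ]
  eval_one_ne_zero := by
    rw [eval_mul]
    refine mul_ne_zero (isStepPoly_pair h₁ h₂).eval_one_ne_zero fun h => ?_
    have := congrArg (eval 1) hA
    rw [eval_mul, h, zero_mul, eval_one_geomPoly] at this
    exact h₃.ne' (by exact_mod_cast this.symm)

end Periods

end PosOrth

open PosOrth in
theorem theorem1p2 (T₁ T₂ T₃ : ℕ) (hT₁ : 0 < T₁) (hT₂ : 0 < T₂) (hT₃ : 0 < T₃)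
    (g : ℕ) (hg : g = Nat.gcd (Nat.gcd T₁ T₂) T₃) :
    ∃ p q r : ℕ, 0 < p ∧ 0 < q ∧ 0 < r ∧
      Nat.gcd T₁ T₃ = q * g ∧ Nat.gcd T₂ T₃ = r * g ∧ T₃ = p * q * r * g ∧
      ∃ (N : ℕ) (a : ℕ → ℝ), (N : ℤ) = p * q * r - q - r + 1 ∧
        PosOrth.IsOrthogonalFunction ![(T₁ : ℝ), (T₂ : ℝ)] (PosOrth.h2 T₁ T₂) ∧
        (∀ h₂ h₃ : ℝ → ℝ, PosOrth.IsOrthogonalFunction ![(T₁ : ℝ), (T₂ : ℝ)] h₂ →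
          (PosOrth.IsOrthogonalFunction ![(T₁ : ℝ), (T₂ : ℝ), (T₃ : ℝ)] h₃ ↔
            ∃ c : ℝ, c ≠ 0 ∧ ∀ᵐ t : ℝ ∂MeasureTheory.volume,
              h₃ t = c * ∑ j ∈ Finset.range (N + 1), a j * h₂ (t - j * g))) ∧
        (q = 1 → N = p * r - r ∧ ∀ j ≤ N, a j = PosOrth.oneZeros r j) ∧
        (r = 1 → N = p * q - q ∧ ∀ j ≤ N, a j = PosOrth.oneZeros q j) ∧
        (2 ≤ q → 2 ≤ r →
          (∀ j, j + q * r ≤ N → a (j + q * r) = a j) ∧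
          (∀ j ≤ N, a j = PosOrth.shiftedSum q r j) ∧
          Function.Periodic (PosOrth.shiftedSum q r) (q * r) ∧
          PosOrth.shiftedSum q r = PosOrth.shiftedSum r q) := by
  have hg0 : 0 < g := hg ▸ Nat.gcd_pos_of_pos_right _ hT₃
  have hgR : (0 : ℝ) < g := Nat.cast_pos.2 hg0
  obtain ⟨t₁, rfl⟩ : g ∣ T₁ := hg ▸ (Nat.gcd_dvd_left _ _).trans (Nat.gcd_dvd_left _ _)
  obtain ⟨t₂, rfl⟩ : g ∣ T₂ := hg ▸ (Nat.gcd_dvd_left _ _).trans (Nat.gcd_dvd_right _ _)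
  obtain ⟨t₃, rfl⟩ : g ∣ T₃ := hg ▸ Nat.gcd_dvd_right _ _
  have h₁ := Nat.pos_of_mul_pos_left hT₁
  have h₂ := Nat.pos_of_mul_pos_left hT₂
  have h₃ := Nat.pos_of_mul_pos_left hT₃
  have hone : (t₁.gcd t₂).gcd t₃ = 1 := by
    rw [Nat.gcd_mul_left, Nat.gcd_mul_left] at hg
    exact Nat.eq_of_mul_eq_mul_left hg0 (by rw [← hg, mul_one])
  have hcop : (t₁.gcd t₃).Coprime (t₂.gcd t₃) := by
    refine Nat.eq_one_of_dvd_one (hone ▸ Nat.dvd_gcd (Nat.dvd_gcd ?_ ?_) ?_)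
    · exact (Nat.gcd_dvd_left _ _).trans (Nat.gcd_dvd_left _ _)
    · exact (Nat.gcd_dvd_right _ _).trans (Nat.gcd_dvd_left _ _)
    · exact (Nat.gcd_dvd_left _ _).trans (Nat.gcd_dvd_right _ _)
  obtain ⟨p, hp⟩ : t₁.gcd t₃ * t₂.gcd t₃ ∣ t₃ :=
    hcop.mul_dvd_of_dvd_of_dvd (Nat.gcd_dvd_right _ _) (Nat.gcd_dvd_right _ _)
  have hq0 : 0 < t₁.gcd t₃ := Nat.gcd_pos_of_pos_right _ h₃
  have hr0 : 0 < t₂.gcd t₃ := Nat.gcd_pos_of_pos_right _ h₃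
  have hp0 : 0 < p := Nat.pos_of_ne_zero fun h => by rw [h, mul_zero] at hp; omega
  have hp' : p * t₁.gcd t₃ * t₂.gcd t₃ = t₃ := by rw [mul_assoc, mul_comm, ← hp]
  obtain ⟨A, hA⟩ := exists_cofactor (p := p) hq0 hcop
  have hA₃ := hA
  rw [hp'] at hA₃
  have hdeg := natDegree_cofactor hp0 hq0 hr0 hA
  have hpair := isStepPoly_pair h₁ h₂
  have htriple := isStepPoly_triple h₁ h₂ h₃ hcop hA₃
  have hτ₂ : ∀ i, ![((g * t₁ : ℕ) : ℝ), ((g * t₂ : ℕ) : ℝ)] i = (![t₁, t₂] i : ℕ) * (g : ℝ) := by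
    intro i
    fin_cases i <;> simp [mul_comm]
  have hτ₃ : ∀ i, ![((g * t₁ : ℕ) : ℝ), ((g * t₂ : ℕ) : ℝ), ((g * t₃ : ℕ) : ℝ)] i =
      (![t₁, t₂, t₃] i : ℕ) * (g : ℝ) := by
    intro i
    fin_cases i <;> simp [mul_comm]
  refine ⟨p, t₁.gcd t₃, t₂.gcd t₃, hp0, hq0, hr0, ?_, ?_, ?_, A.natDegree, A.coeff, ?_, ?_, ?_,
    ?_, ?_, ?_⟩
  · rw [Nat.gcd_mul_left, mul_comm]
  · rw [Nat.gcd_mul_left, mul_comm]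
  · rw [hp', mul_comm]
  · have : ((A.natDegree + t₁.gcd t₃ + t₂.gcd t₃ : ℕ) : ℤ) =
      (p * t₁.gcd t₃ * t₂.gcd t₃ + 1 : ℕ) := by rw [hdeg]
    push_cast at this
    linarith
  · rw [hpair.isOrthogonalFunction_iff hgR hτ₂]
    refine ⟨1, one_ne_zero, .of_forall fun x => ?_⟩
    rw [one_mul, mul_comm g, mul_comm g, h2_eq_stepFn hg0]
  · intro f₂ f₃ hf₂
    obtain ⟨c₂, hc₂, hae⟩ := (hpair.isOrthogonalFunction_iff hgR hτ₂ f₂).1 hf₂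
    have hsum : ∀ᵐ x, ∑ j ∈ Finset.range (A.natDegree + 1), A.coeff j * f₂ (x - j * g) =
        c₂ * stepFn g (pairPoly ℝ t₁ t₂ * A) x := by
      have hshift (j : ℕ) : ∀ᵐ x : ℝ, f₂ (x - j * g) =
          c₂ * stepFn g (pairPoly ℝ t₁ t₂) (x - j * g) :=
        (MeasureTheory.measurePreserving_sub_right MeasureTheory.volume
          ((j : ℝ) * g)).quasiMeasurePreserving.ae hae
      filter_upwards [MeasureTheory.ae_all_iff.2 hshift] with x hx
      rw [stepFn_mul hgR, Finset.mul_sum]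
      refine Finset.sum_congr rfl fun j _ => ?_
      rw [hx j, mul_left_comm]
    rw [htriple.isOrthogonalFunction_iff hgR hτ₃]
    constructor
    · rintro ⟨c, hc, h⟩
      refine ⟨c / c₂, div_ne_zero hc hc₂, ?_⟩
      filter_upwards [h, hsum] with x hx hs
      rw [hx, hs, ← mul_assoc, div_mul_cancel₀ _ hc₂]
    · rintro ⟨c, hc, h⟩
      refine ⟨c * c₂, mul_ne_zero hc hc₂, ?_⟩
      filter_upwards [h, hsum] with x hx hs
      rw [hx, hs, mul_assoc]
  · intro hq
    rw [hq] at hA hdeg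
    refine ⟨?_, fun j hj => coeff_cofactor_of_eq_one hp0 hr0 ?_ hj⟩
    · rw [mul_one] at hdeg
      omega
    · simpa [geomPoly] using hA
  · intro hr
    rw [hr] at hA hdeg
    refine ⟨?_, fun j hj => coeff_cofactor_of_eq_one hp0 hq0 ?_ hj⟩
    · rw [mul_one] at hdeg
      omega
    · simpa [geomPoly] using hA
  · intro hq hr
    have hper := shiftedSum_periodic hq hr hcop
    have hcoeff (j : ℕ) (hj : j ≤ A.natDegree) := coeff_cofactor_of_two_le hp0 hq hr hA hj
    refine ⟨fun j hj => ?_, hcoeff, hper, shiftedSum_comm hq hr⟩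
    rw [hcoeff _ hj, hcoeff j (by omega)]
    exact hper j
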